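/- Let $X$ be a finite-dimensional real normed space with closed unit ball $B$ and unit sphere $S$, and let $X^*$ be its dual with the dual norm. The following are equivalent: (a) $X$ is boundedly semitransitive, i.e. there is a constant $K$ such that for all $x,y\in S$ there is a linear automorphism $T$ of $X$ with $\|T\|\le 1$, $Tx=y$ and $\|T^{-1}\|\le K$. (b) $X^*$ is boundedly semitransitive. (c) There is a constant $\lambda$ such that for every $x\in S$ there are an inner ellipsoid $E$ at $x$ and an outer ellipsoid $F$ at $x$ with $F\subset\lambda E$. Here an ellipsoid is the closed unit ball, centered at the origin, of a Euclidean (inner product) norm on $X$ equivalent to the given one; $E$ is inner at $x$ if $E\subset B$ and $x\in E$; $F$ is outer at $x$ if $B\subset F$ and $x\in\partial F$. (d) $X$ has moduli of uniform convexity and uniform smoothness of power type $2$, i.e. there are constants $c>0$ and $C$ such that $\delta_X(\varepsilon)\ge c\,\varepsilon^2$ for all $0<\varepsilon\le 2$ and $\rho_X(\tau)\le C\,\tau^2$ for all $\tau>0$, where $$\delta_X(\varepsilon)=\inf\Bigl\{1-\Bigl\|\frac{x+y}{2}\Bigr\| : \|x-y\|\ge\varepsilon,\ \|x\|,\|y\|\le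 1\Bigr\},\qquad \rho_X(\tau)=\sup\Bigl\{\frac{\|x+y\|+\|x-y\|}{2}-1 : \|x\|=1,\ \|y\|=\tau\Bigr\}.$$ (For $X=\{0\}$, where both sets are empty, both inequalities are understood to hold.) -/

import Mathlib

open scoped Pointwise

/-- A normed space is boundedly semitransitive if there is a constant `K` such that any point `x` of
the unit sphere is sent to any other point `y` of the unit sphere by some contractive automorphism
`T` whose inverse has norm at most `K`. -/
def BoundedlySemitransitive (X : Type*) [NormedAddCommGroup X] [NormedSpace ℝ X] : Prop :=
  ∃ K : ℝ, ∀ x y : X, ‖x‖ = 1 → ‖y‖ = 1 →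
    ∃ T : X ≃L[ℝ] X, ‖(T : X →L[ℝ] X)‖ ≤ 1 ∧ T x = y ∧ ‖(T.symm : X →L[ℝ] X)‖ ≤ K

/-- An ellipsoid (centred at the origin): the closed unit ball `{z | |z| ≤ 1}` of a Euclidean norm
`|z| = √⟨z, z⟩` on `X` that is equivalent to the given norm of `X`. The inner product `⟨·,·⟩` is
given as a symmetric positive definite bilinear form. -/
def IsEllipsoid {X : Type*} [NormedAddCommGroup X] [NormedSpace ℝ X] (E : Set X) : Prop :=
  ∃ b : LinearMap.BilinForm ℝ X,
    (∀ u v : X, b u v = b v u) ∧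
    (∀ u : X, u ≠ 0 → 0 < b u u) ∧
    (∃ m M : ℝ, 0 < m ∧ 0 < M ∧ ∀ u : X, m * ‖u‖ ≤ √(b u u) ∧ √(b u u) ≤ M * ‖u‖) ∧
    E = {z : X | √(b z z) ≤ 1}

/-- `E` is an inner ellipsoid at `x`: it is contained in the unit ball and contains `x`. -/
def IsInnerEllipsoidAt {X : Type*} [NormedAddCommGroup X] [NormedSpace ℝ X]
    (E : Set X) (x : X) : Prop :=
  IsEllipsoid E ∧ E ⊆ Metric.closedBall 0 1 ∧ x ∈ E

/-- `F` is an outer ellipsoid at `x`: it contains the unit ball and has `x` on its boundary. -/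
def IsOuterEllipsoidAt {X : Type*} [NormedAddCommGroup X] [NormedSpace ℝ X]
    (F : Set X) (x : X) : Prop :=
  IsEllipsoid F ∧ Metric.closedBall 0 1 ⊆ F ∧ x ∈ frontier F

/-- The modulus of uniform convexity
`δ_X(ε) = inf {1 - ‖(x + y)/2‖ : ‖x - y‖ ≥ ε, ‖x‖ ≤ 1, ‖y‖ ≤ 1}`, as an infimum of extended reals
(so that the infimum over the empty set, which occurs only for the zero space when `0 < ε ≤ 2`,
is `⊤`). -/
noncomputable def convexityModulus (X : Type*) [NormedAddCommGroup X] [NormedSpace ℝ X]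
    (ε : ℝ) : EReal :=
  ⨅ (x : X) (y : X) (_ : ‖x‖ ≤ 1) (_ : ‖y‖ ≤ 1) (_ : ε ≤ ‖x - y‖),
    ((1 - ‖(1 / 2 : ℝ) • (x + y)‖ : ℝ) : EReal)

/-- The modulus of uniform smoothness
`ρ_X(τ) = sup {(‖x + y‖ + ‖x - y‖)/2 - 1 : ‖x‖ = 1, ‖y‖ = τ}`, as a supremum of extended reals. -/
noncomputable def smoothnessModulus (X : Type*) [NormedAddCommGroup X] [NormedSpace ℝ X]
    (τ : ℝ) : EReal :=
  ⨆ (x : X) (y : X) (_ : ‖x‖ = 1) (_ : ‖y‖ = τ),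
    (((‖x + y‖ + ‖x - y‖) / 2 - 1 : ℝ) : EReal)

/-- The modulus of uniform convexity is of power type 2. -/
def ConvexityPowerTypeTwo (X : Type*) [NormedAddCommGroup X] [NormedSpace ℝ X] : Prop :=
  ∃ c : ℝ, 0 < c ∧ ∀ ε : ℝ, 0 < ε → ε ≤ 2 → ((c * ε ^ 2 : ℝ) : EReal) ≤ convexityModulus X ε

/-- The modulus of uniform smoothness is of power type 2. -/
def SmoothnessPowerTypeTwo (X : Type*) [NormedAddCommGroup X] [NormedSpace ℝ X] : Prop :=
  ∃ C : ℝ, ∀ τ : ℝ, 0 < τ → smoothnessModulus X τ ≤ ((C * τ ^ 2 : ℝ) : EReal)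

/-!
An ellipsoid is the unit ball of a norm `u ↦ ‖φ u‖`, where `φ` is a linear isomorphism of `X` onto
the Euclidean space of the same dimension (`isEllipsoid_iff`). Hence the ellipsoid condition says that at
every unit vector `x` the given norm is squeezed, `‖ψ u‖ ≤ ‖u‖ ≤ ‖φ u‖`, between two Euclidean norms
that take the value `1` at `x` and are uniformly comparable, `‖φ u‖ ≤ L * ‖ψ u‖`
(`UniformlyEuclideanPinched`, `exists_ellipsoids_iff`).

* Pinching gives semitransitivity: reflections act transitively on the Euclidean unit sphere, so
  some isomorphism takes the outer ellipsoid at `x` onto the inner ellipsoid at `y` and `x` to `y`.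
  It is contractive because `B ⊆ F` and `E ⊆ B`, and its inverse has norm at most `L ^ 2`.
* Semitransitivity gives pinching: a Euclidean ball can be scaled until it touches the unit sphere
  from inside, or from outside, at *some* point. The contractions `T` move these touching points
  everywhere, at the cost of a factor depending on `‖T⁻¹‖`.
* Pinching gives both moduli by the parallelogram law for `‖ψ ·‖` and `‖φ ·‖`.
* Conversely, let `f` support the unit ball at `x` and let `h` be in the kernel of `f`. The two moduli
  yield `t ^ 2 + c * ‖h‖ ^ 2 ≤ ‖t • x + h‖ ^ 2 ≤ t ^ 2 + C * ‖h‖ ^ 2`, and in finite dimension `‖h‖`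
  may be replaced here by a fixed Euclidean norm, which exhibits the two ellipsoids.
* Duality: an inner ellipsoid at `x` makes the support functional at `x` unique. If `T x = y` with
  `T` contractive, and `g` supports the ball at `y`, then `g ∘ T` supports it at `x`; so the
  adjoints of the maps `T` show that the dual is semitransitive (`BoundedlySemitransitive.dual`).
  The converse follows by reflexivity.
-/

/-! ### Euclidean norms on finite-dimensional spaces -/

/-- A positive definite symmetric form is the pull-back of the standard inner product. The space is
only assumed to be a vector space, so that no second norm interferes with the one defined by `b`. -/
lemma exists_linearEquiv_euclideanSpace {V : Type*} [AddCommGroup V] [Module ℝ V]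
    [FiniteDimensional ℝ V] (b : LinearMap.BilinForm ℝ V) (hsymm : ∀ u v, b u v = b v u)
    (hpos : ∀ u, u ≠ 0 → 0 < b u u) :
    ∃ φ : V ≃ₗ[ℝ] EuclideanSpace ℝ (Fin (Module.finrank ℝ V)), ∀ u, ‖φ u‖ ^ 2 = b u u := by
  let core : InnerProductSpace.Core ℝ V :=
    { inner := fun u v => b u v
      conj_inner_symm := fun u v => by simp [hsymm u v]
      re_inner_nonneg := fun u => by
        by_cases hu : u = 0
        · simp [hu]
        · simpa using (hpos u hu).le
      add_left := fun u v w => by simp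
      smul_left := fun u v r => by simp
      definite := fun u hu => by
        by_contra h
        exact (hpos u h).ne' hu }
  let _ : NormedAddCommGroup V := core.toNormedAddCommGroup
  let _ : InnerProductSpace ℝ V := InnerProductSpace.ofCore core.toCore
  refine ⟨(stdOrthonormalBasis ℝ V).repr.toLinearEquiv, fun u => ?_⟩
  have h := (stdOrthonormalBasis ℝ V).repr.norm_map u
  change ‖(stdOrthonormalBasis ℝ V).repr u‖ ^ 2 = _
  rw [h, ← real_inner_self_eq_norm_sq]
  rfl

section

variable {X : Type*} [NormedAddCommGroup X] [NormedSpace ℝ X]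

/-- Continuous linear isomorphisms of `X` onto the Euclidean space of the same dimension. The norms
`u ↦ ‖φ u‖` are exactly the Euclidean norms on a finite-dimensional `X`. -/
abbrev EuclideanCoordinates (X : Type*) [NormedAddCommGroup X] [NormedSpace ℝ X] : Type _ :=
  X ≃L[ℝ] EuclideanSpace ℝ (Fin (Module.finrank ℝ X))

lemma norm_inv_norm_smul_of_ne_zero {u : X} (hu : u ≠ 0) : ‖‖u‖⁻¹ • u‖ = 1 := by
  rw [norm_smul, norm_inv, norm_norm, inv_mul_cancel₀ (norm_ne_zero_iff.2 hu)]

lemma exists_bounds_of_continuousLinearEquiv {Y : Type*} [NormedAddCommGroup Y] [NormedSpace ℝ Y]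
    (φ : X ≃L[ℝ] Y) :
    ∃ m M : ℝ, 0 < m ∧ 0 < M ∧ ∀ u, m * ‖u‖ ≤ ‖φ u‖ ∧ ‖φ u‖ ≤ M * ‖u‖ := by
  have hs : 0 < ‖(φ.symm : Y →L[ℝ] X)‖ + 1 := by positivity
  refine ⟨(‖(φ.symm : Y →L[ℝ] X)‖ + 1)⁻¹, ‖(φ : X →L[ℝ] Y)‖ + 1, by positivity, by positivity,
    fun u => ⟨?_, ?_⟩⟩
  · rw [inv_mul_le_iff₀ hs]
    have h := (φ.symm : Y →L[ℝ] X).le_opNorm (φ u)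
    simp only [ContinuousLinearEquiv.coe_coe, ContinuousLinearEquiv.symm_apply_apply] at h
    nlinarith [norm_nonneg (φ u)]
  · have h := (φ : X →L[ℝ] Y).le_opNorm u
    simp only [ContinuousLinearEquiv.coe_coe] at h
    nlinarith [norm_nonneg u]

lemma isEllipsoid_iff [FiniteDimensional ℝ X] {E : Set X} :
    IsEllipsoid E ↔ ∃ φ : EuclideanCoordinates X, E = {z | ‖φ z‖ ≤ 1} := by
  constructor
  · rintro ⟨b, hsymm, hpos, -, rfl⟩
    obtain ⟨φ, hφ⟩ := exists_linearEquiv_euclideanSpace b hsymm hpos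
    refine ⟨φ.toContinuousLinearEquiv, ?_⟩
    ext z
    simp [← hφ]
  · rintro ⟨φ, rfl⟩
    obtain ⟨m, M, hm, hM, hφ⟩ := exists_bounds_of_continuousLinearEquiv φ
    let A : X →ₗ[ℝ] EuclideanSpace ℝ (Fin (Module.finrank ℝ X)) := φ.toLinearEquiv
    let b : LinearMap.BilinForm ℝ X := (innerₗ _).compl₁₂ A A
    have hb : ∀ u v, b u v = inner ℝ (φ u) (φ v) := fun u v => rfl
    have hsq : ∀ u, √(b u u) = ‖φ u‖ := fun u => by
      rw [hb, real_inner_self_eq_norm_sq, Real.sqrt_sq (norm_nonneg _)]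
    refine ⟨b, fun u v => by rw [hb, hb, real_inner_comm], fun u hu => ?_,
      ⟨m, M, hm, hM, fun u => by rw [hsq]; exact hφ u⟩, by simp only [hsq]⟩
    rw [hb, real_inner_self_eq_norm_sq]
    have : φ u ≠ 0 := by simpa using hu
    positivity

lemma setOf_norm_le_one_subset_closedBall_iff (φ : EuclideanCoordinates X) :
    {z | ‖φ z‖ ≤ 1} ⊆ Metric.closedBall 0 1 ↔ ∀ u, ‖u‖ ≤ ‖φ u‖ := by
  constructor
  · intro h u
    by_cases hu : u = 0
    · simp [hu]
    have hpos : 0 < ‖φ u‖ := by simpa using hu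
    have := h (show ‖φ (‖φ u‖⁻¹ • u)‖ ≤ 1 by
      rw [map_smul, norm_smul, norm_inv, norm_norm, inv_mul_cancel₀ hpos.ne'])
    rw [mem_closedBall_zero_iff, norm_smul, norm_inv, norm_norm, inv_mul_le_iff₀ hpos] at this
    simpa using this
  · intro h u hu
    rw [mem_closedBall_zero_iff]
    exact (h u).trans hu

lemma closedBall_subset_setOf_norm_le_one_iff (φ : EuclideanCoordinates X) :
    Metric.closedBall 0 1 ⊆ {z | ‖φ z‖ ≤ 1} ↔ ∀ u, ‖φ u‖ ≤ ‖u‖ := by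
  constructor
  · intro h u
    by_cases hu : u = 0
    · simp [hu]
    have hpos : 0 < ‖u‖ := by simpa using hu
    have := h (show ‖u‖⁻¹ • u ∈ Metric.closedBall (0 : X) 1 by
      rw [mem_closedBall_zero_iff, norm_inv_norm_smul_of_ne_zero hu])
    rw [Set.mem_ofPred_eq, map_smul, norm_smul, norm_inv, norm_norm, inv_mul_le_iff₀ hpos] at this
    simpa using this
  · intro h u hu
    rw [mem_closedBall_zero_iff] at hu
    exact (h u).trans hu

lemma mem_frontier_setOf_norm_le_one_iff (φ : EuclideanCoordinates X) {x : X} :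
    x ∈ frontier {z | ‖φ z‖ ≤ 1} ↔ ‖φ x‖ = 1 := by
  have h : {z | ‖φ z‖ ≤ 1} = φ.toHomeomorph ⁻¹' Metric.closedBall 0 1 := by
    ext z; simp
  rw [h, ← Homeomorph.preimage_frontier, frontier_closedBall _ one_ne_zero]
  simp

lemma isInnerEllipsoidAt_iff [FiniteDimensional ℝ X] {E : Set X} {x : X} (hx : ‖x‖ = 1) :
    IsInnerEllipsoidAt E x ↔ ∃ φ : EuclideanCoordinates X,
      E = {z | ‖φ z‖ ≤ 1} ∧ (∀ u, ‖u‖ ≤ ‖φ u‖) ∧ ‖φ x‖ = 1 := by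
  rw [IsInnerEllipsoidAt, isEllipsoid_iff]
  constructor
  · rintro ⟨⟨φ, rfl⟩, h, hxE⟩
    rw [setOf_norm_le_one_subset_closedBall_iff] at h
    exact ⟨φ, rfl, h, le_antisymm hxE (hx ▸ h x)⟩
  · rintro ⟨φ, rfl, h, hφx⟩
    exact ⟨⟨φ, rfl⟩, (setOf_norm_le_one_subset_closedBall_iff φ).2 h, hφx.le⟩

lemma isOuterEllipsoidAt_iff [FiniteDimensional ℝ X] {F : Set X} {x : X} :
    IsOuterEllipsoidAt F x ↔ ∃ ψ : EuclideanCoordinates X,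
      F = {z | ‖ψ z‖ ≤ 1} ∧ (∀ u, ‖ψ u‖ ≤ ‖u‖) ∧ ‖ψ x‖ = 1 := by
  rw [IsOuterEllipsoidAt, isEllipsoid_iff]
  constructor
  · rintro ⟨⟨ψ, rfl⟩, h, hxF⟩
    exact ⟨ψ, rfl, (closedBall_subset_setOf_norm_le_one_iff ψ).1 h,
      (mem_frontier_setOf_norm_le_one_iff ψ).1 hxF⟩
  · rintro ⟨ψ, rfl, h, hψx⟩
    exact ⟨⟨ψ, rfl⟩, (closedBall_subset_setOf_norm_le_one_iff ψ).2 h,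
      (mem_frontier_setOf_norm_le_one_iff ψ).2 hψx⟩

lemma norm_le_abs_mul_norm_of_subset_smul {φ ψ : EuclideanCoordinates X} {l : ℝ}
    (h : {z | ‖ψ z‖ ≤ 1} ⊆ l • {z | ‖φ z‖ ≤ 1}) (u : X) : ‖φ u‖ ≤ |l| * ‖ψ u‖ := by
  by_cases hu : u = 0
  · simp [hu]
  have hpos : 0 < ‖ψ u‖ := by simpa using hu
  obtain ⟨z, hz, hzu⟩ := h (show ‖ψ (‖ψ u‖⁻¹ • u)‖ ≤ 1 by
    rw [map_smul, norm_smul, norm_inv, norm_norm, inv_mul_cancel₀ hpos.ne'])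
  have h1 : ‖φ (‖ψ u‖⁻¹ • u)‖ ≤ |l| := by
    rw [← hzu]
    change ‖φ (l • z)‖ ≤ |l|
    rw [map_smul, norm_smul, Real.norm_eq_abs]
    exact mul_le_of_le_one_right (abs_nonneg l) hz
  rw [map_smul, norm_smul, norm_inv, norm_norm, inv_mul_le_iff₀ hpos] at h1
  linarith [mul_comm (‖ψ u‖) |l|]

/-! ### Pinching between Euclidean norms -/

/-- At every unit vector `x` the norm lies between two Euclidean norms `‖ψ ·‖ ≤ ‖·‖ ≤ ‖φ ·‖` that
take the value `1` at `x` and satisfy `‖φ ·‖ ≤ L * ‖ψ ·‖` with a constant `L` independent of `x`.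
The unit balls of `‖φ ·‖` and `‖ψ ·‖` are the inner and the outer ellipsoid at `x`. -/
def UniformlyEuclideanPinched (X : Type*) [NormedAddCommGroup X] [NormedSpace ℝ X] : Prop :=
  ∃ L : ℝ, ∀ x : X, ‖x‖ = 1 → ∃ φ ψ : EuclideanCoordinates X,
    (∀ u, ‖u‖ ≤ ‖φ u‖) ∧ ‖φ x‖ = 1 ∧ (∀ u, ‖ψ u‖ ≤ ‖u‖) ∧ ‖ψ x‖ = 1 ∧
    ∀ u, ‖φ u‖ ≤ L * ‖ψ u‖

lemma exists_ellipsoids_iff [FiniteDimensional ℝ X] :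
    (∃ lam : ℝ, ∀ x : X, ‖x‖ = 1 → ∃ E F : Set X,
      IsInnerEllipsoidAt E x ∧ IsOuterEllipsoidAt F x ∧ F ⊆ lam • E) ↔
    UniformlyEuclideanPinched X := by
  constructor
  · rintro ⟨l, h⟩
    refine ⟨|l|, fun x hx => ?_⟩
    obtain ⟨E, F, hE, hF, hFE⟩ := h x hx
    obtain ⟨φ, rfl, hφ, hφx⟩ := (isInnerEllipsoidAt_iff hx).1 hE
    obtain ⟨ψ, rfl, hψ, hψx⟩ := isOuterEllipsoidAt_iff.1 hF
    exact ⟨φ, ψ, hφ, hφx, hψ, hψx, norm_le_abs_mul_norm_of_subset_smul hFE⟩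
  · rintro ⟨L, h⟩
    refine ⟨L, fun x hx => ?_⟩
    obtain ⟨φ, ψ, hφ, hφx, hψ, hψx, hL⟩ := h x hx
    refine ⟨_, _, (isInnerEllipsoidAt_iff hx).2 ⟨φ, rfl, hφ, hφx⟩,
      isOuterEllipsoidAt_iff.2 ⟨ψ, rfl, hψ, hψx⟩, fun z hz => ?_⟩
    -- Evaluating the comparison at `x` itself shows that `L` is positive.
    have hLpos : 0 < L := by
      have := hL x
      rw [hφx, hψx] at this
      linarith
    rw [Set.mem_smul_set_iff_inv_smul_mem₀ hLpos.ne', Set.mem_ofPred_eq, map_smul, norm_smul,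
      norm_inv, Real.norm_of_nonneg hLpos.le, inv_mul_le_iff₀ hLpos]
    exact (hL z).trans (mul_le_mul_of_nonneg_left hz hLpos.le)

lemma UniformlyEuclideanPinched.boundedlySemitransitive (h : UniformlyEuclideanPinched X) :
    BoundedlySemitransitive X := by
  obtain ⟨L, h⟩ := h
  refine ⟨L * L, fun x y hx hy => ?_⟩
  obtain ⟨φx, ψx, hφx, hφx1, hψx, hψx1, hLx⟩ := h x hx
  obtain ⟨φy, ψy, hφy, hφy1, hψy, hψy1, hLy⟩ := h y hy
  have hL : 0 ≤ L := by
    have := hLx x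
    rw [hφx1, hψx1] at this
    linarith
  let R := (Submodule.span ℝ {ψx x - φy y})ᗮ.reflection
  have hR : R (ψx x) = φy y := Submodule.reflection_sub (by rw [hψx1, hφy1])
  refine ⟨(ψx.trans R.toContinuousLinearEquiv).trans φy.symm, ?_, ?_, ?_⟩
  · refine ContinuousLinearMap.opNorm_le_bound _ zero_le_one fun u => ?_
    refine (hφy _).trans ?_
    simpa using hψx u
  · simp [hR]
  · refine ContinuousLinearMap.opNorm_le_bound _ (by positivity) fun u => ?_
    refine ((hφx _).trans (hLx _)).trans ?_
    rw [mul_assoc]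
    refine mul_le_mul_of_nonneg_left ?_ hL
    have h1 := (hLy u).trans (mul_le_mul_of_nonneg_left (hψy u) hL)
    have h2 : ‖R.symm (φy u)‖ = ‖φy u‖ := R.symm.norm_map _
    simpa [h2] using h1

lemma BoundedlySemitransitive.uniformlyEuclideanPinched [FiniteDimensional ℝ X]
    (h : BoundedlySemitransitive X) :
    UniformlyEuclideanPinched X := by
  obtain ⟨K, h⟩ := h
  rcases subsingleton_or_nontrivial X with hX | hX
  · refine ⟨0, fun x hx => ?_⟩
    simp [Subsingleton.elim x 0] at hx
  let e : EuclideanCoordinates X := toEuclidean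
  have hne : (Metric.sphere (0 : X) 1).Nonempty := NormedSpace.sphere_nonempty.2 zero_le_one
  have hcont : ContinuousOn (fun u => ‖e u‖) (Metric.sphere (0 : X) 1) :=
    (e.continuous.norm).continuousOn
  obtain ⟨p, hp, hpmin⟩ := (isCompact_sphere (0 : X) 1).exists_isMinOn hne hcont
  obtain ⟨q, hq, hqmax⟩ := (isCompact_sphere (0 : X) 1).exists_isMaxOn hne hcont
  rw [mem_sphere_zero_iff_norm] at hp hq
  have hpe : ∀ u, ‖e p‖ * ‖u‖ ≤ ‖e u‖ := fun u => by
    by_cases hu : u = 0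
    · simp [hu]
    have hpos : 0 < ‖u‖ := by simpa using hu
    have := hpmin (show ‖u‖⁻¹ • u ∈ Metric.sphere (0 : X) 1 by
      rw [mem_sphere_zero_iff_norm, norm_inv_norm_smul_of_ne_zero hu])
    simp only [Set.mem_ofPred_eq, map_smul, norm_smul, norm_inv, norm_norm] at this
    rwa [le_inv_mul_iff₀ hpos, mul_comm] at this
  have hqe : ∀ u, ‖e u‖ ≤ ‖e q‖ * ‖u‖ := fun u => by
    by_cases hu : u = 0
    · simp [hu]
    have hpos : 0 < ‖u‖ := by simpa using hu
    have := hqmax (show ‖u‖⁻¹ • u ∈ Metric.sphere (0 : X) 1 by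
      rw [mem_sphere_zero_iff_norm, norm_inv_norm_smul_of_ne_zero hu])
    simp only [Set.mem_ofPred_eq, map_smul, norm_smul, norm_inv, norm_norm] at this
    rwa [inv_mul_le_iff₀ hpos, mul_comm] at this
  have hm : 0 < ‖e p‖ := by
    have : p ≠ 0 := by rintro rfl; simp at hp
    simpa using this
  have hM : 0 < ‖e q‖ := by
    have : q ≠ 0 := by rintro rfl; simp at hq
    simpa using this
  set m := ‖e p‖
  set M := ‖e q‖
  -- The scaled forms `m⁻¹ • e` and `M⁻¹ • e` touch the unit sphere at `p` and at `q`.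
  let φ : EuclideanCoordinates X :=
    e.trans (ContinuousLinearEquiv.smulLeft (Units.mk0 m⁻¹ (inv_ne_zero hm.ne')))
  let ψ : EuclideanCoordinates X :=
    e.trans (ContinuousLinearEquiv.smulLeft (Units.mk0 M⁻¹ (inv_ne_zero hM.ne')))
  have hφ : ∀ u, ‖φ u‖ = m⁻¹ * ‖e u‖ := fun u => by
    change ‖m⁻¹ • e u‖ = _
    rw [norm_smul, Real.norm_of_nonneg (by positivity)]
  have hψ : ∀ u, ‖ψ u‖ = M⁻¹ * ‖e u‖ := fun u => by
    change ‖M⁻¹ • e u‖ = _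
    rw [norm_smul, Real.norm_of_nonneg (by positivity)]
  have hφ1 : ∀ u, ‖u‖ ≤ ‖φ u‖ := fun u => by rw [hφ, le_inv_mul_iff₀ hm]; exact hpe u
  have hψ1 : ∀ u, ‖ψ u‖ ≤ ‖u‖ := fun u => by rw [hψ, inv_mul_le_iff₀ hM]; exact hqe u
  have hφψ : ∀ u, ‖φ u‖ = M / m * ‖ψ u‖ := fun u => by rw [hφ, hψ]; field_simp
  refine ⟨M / m * (K * (K * (M / m))), fun x hx => ?_⟩
  obtain ⟨T, hT, hTp, hTK⟩ := h p x hp hx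
  obtain ⟨S, hS, hSx, hSK⟩ := h x q hx hq
  have hK : 0 ≤ K := (norm_nonneg _).trans hTK
  have hT1 : ∀ u, ‖u‖ ≤ ‖T.symm u‖ := fun u => by
    simpa using (T : X →L[ℝ] X).le_of_opNorm_le hT (T.symm u)
  have hT2 : ∀ u, ‖T.symm u‖ ≤ K * ‖u‖ := fun u =>
    (T.symm : X →L[ℝ] X).le_of_opNorm_le hTK u
  have hS1 : ∀ u, ‖S u‖ ≤ ‖u‖ := fun u => by
    simpa using (S : X →L[ℝ] X).le_of_opNorm_le hS u
  have hS2 : ∀ u, ‖u‖ ≤ K * ‖S u‖ := fun u => by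
    simpa using (S.symm : X →L[ℝ] X).le_of_opNorm_le hSK (S u)
  refine ⟨T.symm.trans φ, S.trans ψ, fun u => (hT1 u).trans (hφ1 _), ?_,
    fun u => (hψ1 _).trans (hS1 u), ?_, fun u => ?_⟩
  · have : T.symm x = p := by rw [← hTp, T.symm_apply_apply]
    change ‖φ (T.symm x)‖ = 1
    rw [this, hφ, inv_mul_cancel₀ hm.ne']
  · change ‖ψ (S x)‖ = 1
    rw [hSx, hψ, inv_mul_cancel₀ hM.ne']
  · change ‖φ (T.symm u)‖ ≤ _ * ‖ψ (S u)‖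
    calc ‖φ (T.symm u)‖ = M / m * ‖ψ (T.symm u)‖ := hφψ _
      _ ≤ M / m * (K * ‖u‖) := by gcongr; exact (hψ1 _).trans (hT2 u)
      _ ≤ M / m * (K * (K * ‖φ (S u)‖)) := by gcongr; exact (hS2 u).trans (by gcongr; exact hφ1 _)
      _ = M / m * (K * (K * (M / m))) * ‖ψ (S u)‖ := by rw [hφψ]; ring

/-! ### Duality -/

/-- An inner ellipsoid at `x` determines the support functional at `x`: it is `⟪φ x, φ ·⟫`. -/
lemma apply_eq_inner_of_norm_le {φ : EuclideanCoordinates X} {x : X} (hφ : ∀ u, ‖u‖ ≤ ‖φ u‖)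
    (hφx : ‖φ x‖ = 1) {f : StrongDual ℝ X} (hf : ‖f‖ ≤ 1) (hfx : f x = 1) (u : X) :
    f u = inner ℝ (φ x) (φ u) := by
  set s := inner ℝ (φ x) (φ u) with hs
  set h := u - s • x with hh
  have horth : inner ℝ (φ x) (φ h) = 0 := by
    rw [hh, map_sub, map_smul, inner_sub_right, inner_smul_right, real_inner_self_eq_norm_sq, hφx]
    simp [hs]
  have key : ∀ t : ℝ, (1 + t * f h) ^ 2 ≤ 1 + t ^ 2 * ‖φ h‖ ^ 2 := fun t => by
    have h1 : |1 + t * f h| ≤ ‖φ x + t • φ h‖ := by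
      have h2 := (f.le_of_opNorm_le hf (x + t • h)).trans ((one_mul _).le.trans (hφ _))
      simpa [hfx] using h2
    have h2 : ‖φ x + t • φ h‖ ^ 2 = 1 + t ^ 2 * ‖φ h‖ ^ 2 := by
      rw [norm_add_sq_real, inner_smul_right, horth, hφx, norm_smul, mul_pow, Real.norm_eq_abs,
        sq_abs]
      ring
    rw [← h2, ← sq_abs]
    gcongr
  have hfh : f h = 0 := by
    by_contra hne
    have hpos : 0 < f h ^ 2 := by positivity
    -- For small `t` of the sign of `f h`, the linear term on the left beats the quadratic one.
    have h1 := key (f h / (‖φ h‖ ^ 2 + 1))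
    have hk : 0 < ‖φ h‖ ^ 2 + 1 := by positivity
    rw [div_mul_eq_mul_div, div_pow, div_mul_eq_mul_div] at h1
    have h2 : f h ^ 2 * ‖φ h‖ ^ 2 / (‖φ h‖ ^ 2 + 1) ^ 2 ≤ f h * f h / (‖φ h‖ ^ 2 + 1) := by
      rw [div_le_div_iff₀ (by positivity) hk]
      nlinarith [mul_nonneg hpos.le hk.le]
    have h3 : 0 < f h * f h / (‖φ h‖ ^ 2 + 1) := by
      rw [← sq]
      positivity
    nlinarith
  have : f u = f h + s * f x := by simp [hh]
  rw [this, hfh, hfx]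
  ring

/-- Finite-dimensional spaces are reflexive. -/
lemma exists_linearIsometryEquiv_doubleDual [FiniteDimensional ℝ X] :
    ∃ J : X ≃ₗᵢ[ℝ] StrongDual ℝ (StrongDual ℝ X), ∀ x f, J x f = f x := by
  have hdual : ∀ (Y : Type _) [NormedAddCommGroup Y] [NormedSpace ℝ Y] [FiniteDimensional ℝ Y],
      Module.finrank ℝ (StrongDual ℝ Y) = Module.finrank ℝ Y := fun Y _ _ _ => by
    rw [← Subspace.dual_finrank_eq (K := ℝ) (V := Y)]
    exact (LinearMap.toContinuousLinearMap : (Y →ₗ[ℝ] ℝ) ≃ₗ[ℝ] _).finrank_eq.symm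
  exact ⟨(NormedSpace.inclusionInDoubleDualLi ℝ).toLinearIsometryEquiv
    (by rw [hdual, hdual]), fun x f => rfl⟩

lemma exists_norm_eq_one_apply_eq_one [FiniteDimensional ℝ X] {f : StrongDual ℝ X} (hf : ‖f‖ = 1) :
    ∃ x : X, ‖x‖ = 1 ∧ f x = 1 := by
  obtain ⟨J, hJ⟩ := exists_linearIsometryEquiv_doubleDual (X := X)
  have hne : ‖f‖ ≠ 0 := by simp [hf]
  obtain ⟨G, hG, hGf⟩ := exists_dual_vector ℝ f hne
  refine ⟨J.symm G, (J.symm.norm_map G).trans hG, ?_⟩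
  rw [← hJ, J.apply_symm_apply, hGf, hf]
  simp

lemma BoundedlySemitransitive.dual [FiniteDimensional ℝ X] (h : BoundedlySemitransitive X) :
    BoundedlySemitransitive (StrongDual ℝ X) := by
  obtain ⟨L, hpinch⟩ := h.uniformlyEuclideanPinched
  obtain ⟨K, h⟩ := h
  refine ⟨K, fun g f hg hf => ?_⟩
  obtain ⟨x, hx, hfx⟩ := exists_norm_eq_one_apply_eq_one hf
  obtain ⟨y, hy, hgy⟩ := exists_norm_eq_one_apply_eq_one hg
  obtain ⟨T, hT, hTx, hTK⟩ := h x y hx hy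
  obtain ⟨φ, -, hφ, hφx, -⟩ := hpinch x hx
  have hK : 0 ≤ K := (norm_nonneg _).trans hTK
  have hcomp : ∀ k : StrongDual ℝ X, ‖k.comp (T : X →L[ℝ] X)‖ ≤ 1 * ‖k‖ := fun k => by
    rw [mul_comm]
    exact (k.opNorm_comp_le _).trans (mul_le_mul_of_nonneg_left hT (norm_nonneg _))
  refine ⟨T.symm.arrowCongr (ContinuousLinearEquiv.refl ℝ ℝ), ?_, ?_, ?_⟩
  · refine ContinuousLinearMap.opNorm_le_bound _ zero_le_one fun k => ?_
    exact hcomp k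
  · have hgT : ‖g.comp (T : X →L[ℝ] X)‖ ≤ 1 := by simpa [hg] using hcomp g
    have hgTx : g.comp (T : X →L[ℝ] X) x = 1 := by simp [hTx, hgy]
    ext u
    change g.comp (T : X →L[ℝ] X) u = f u
    rw [apply_eq_inner_of_norm_le hφ hφx hgT hgTx, apply_eq_inner_of_norm_le hφ hφx hf.le hfx]
  · refine ContinuousLinearMap.opNorm_le_bound _ hK fun k => ?_
    change ‖k.comp (T.symm : X →L[ℝ] X)‖ ≤ K * ‖k‖
    rw [mul_comm]
    exact (k.opNorm_comp_le _).trans (mul_le_mul_of_nonneg_left hTK (norm_nonneg _))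

lemma BoundedlySemitransitive.of_linearIsometryEquiv {Y Z : Type*} [NormedAddCommGroup Y]
    [NormedSpace ℝ Y] [NormedAddCommGroup Z] [NormedSpace ℝ Z] (J : Y ≃ₗᵢ[ℝ] Z)
    (h : BoundedlySemitransitive Z) : BoundedlySemitransitive Y := by
  obtain ⟨K, h⟩ := h
  refine ⟨K, fun x y hx hy => ?_⟩
  obtain ⟨T, hT, hTx, hTK⟩ := h (J x) (J y) (by simpa) (by simpa)
  refine ⟨(J.toContinuousLinearEquiv.trans T).trans J.symm.toContinuousLinearEquiv, ?_, ?_, ?_⟩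
  · refine ContinuousLinearMap.opNorm_le_bound _ zero_le_one fun u => ?_
    simpa using (T : Z →L[ℝ] Z).le_of_opNorm_le hT (J u)
  · simp [hTx]
  · refine ContinuousLinearMap.opNorm_le_bound _ ((norm_nonneg _).trans hTK) fun u => ?_
    have h1 := (T.symm : Z →L[ℝ] Z).le_of_opNorm_le hTK (J u)
    have h2 : ‖J.symm (T.symm (J u))‖ = ‖T.symm (J u)‖ := J.symm.norm_map _
    simpa [h2] using h1

/-! ### The moduli of convexity and smoothness -/

lemma convexityPowerTypeTwo_iff :
    ConvexityPowerTypeTwo X ↔ ∃ c : ℝ, 0 < c ∧ ∀ x y : X, ‖x‖ ≤ 1 → ‖y‖ ≤ 1 →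
      c * ‖x - y‖ ^ 2 ≤ 1 - ‖(1 / 2 : ℝ) • (x + y)‖ := by
  constructor
  · rintro ⟨c, hc, h⟩
    refine ⟨c, hc, fun x y hx hy => ?_⟩
    rcases (norm_nonneg (x - y)).eq_or_lt with h0 | h0
    · rw [← h0, norm_smul]
      have := norm_add_le x y
      norm_num
      linarith
    · have h1 := h ‖x - y‖ h0 ((norm_sub_le x y).trans (by linarith))
      have h2 : convexityModulus X ‖x - y‖ ≤ ((1 - ‖(1 / 2 : ℝ) • (x + y)‖ : ℝ) : EReal) :=
        iInf_le_of_le x <| iInf_le_of_le y <| iInf_le_of_le hx <| iInf_le_of_le hy <|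
          iInf_le_of_le le_rfl le_rfl
      exact EReal.coe_le_coe_iff.1 (h1.trans h2)
  · rintro ⟨c, hc, h⟩
    refine ⟨c, hc, fun ε hε _ => ?_⟩
    refine le_iInf fun x => le_iInf fun y => le_iInf fun hx => le_iInf fun hy => le_iInf fun hxy => ?_
    refine EReal.coe_le_coe_iff.2 (le_trans ?_ (h x y hx hy))
    gcongr

lemma smoothnessPowerTypeTwo_iff :
    SmoothnessPowerTypeTwo X ↔ ∃ C : ℝ, ∀ x y : X, ‖x‖ = 1 →
      (‖x + y‖ + ‖x - y‖) / 2 - 1 ≤ C * ‖y‖ ^ 2 := by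
  constructor
  · rintro ⟨C, h⟩
    refine ⟨C, fun x y hx => ?_⟩
    by_cases hy : y = 0
    · simp [hy, hx]
    · have h1 := h ‖y‖ (by simpa using hy)
      have h2 : (((‖x + y‖ + ‖x - y‖) / 2 - 1 : ℝ) : EReal) ≤ smoothnessModulus X ‖y‖ :=
        le_iSup_of_le x <| le_iSup_of_le y <| le_iSup_of_le hx <| le_iSup_of_le rfl le_rfl
      exact EReal.coe_le_coe_iff.1 (h2.trans h1)
  · rintro ⟨C, h⟩
    refine ⟨C, fun τ _ => ?_⟩
    refine iSup_le fun x => iSup_le fun y => iSup_le fun hx => iSup_le fun hy => ?_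
    rw [← hy]
    exact EReal.coe_le_coe_iff.2 (h x y hx)

lemma UniformlyEuclideanPinched.convexityPowerTypeTwo (h : UniformlyEuclideanPinched X) :
    ConvexityPowerTypeTwo X := by
  obtain ⟨L, h⟩ := h
  rw [convexityPowerTypeTwo_iff]
  refine ⟨1 / (8 * (L ^ 2 + 1)), by positivity, fun x y hx hy => ?_⟩
  rw [one_div_mul_eq_div, div_le_iff₀ (by positivity)]
  set z := (1 / 2 : ℝ) • (x + y) with hz
  by_cases hz0 : z = 0
  · have := norm_sub_le x y
    rw [hz0, norm_zero]
    nlinarith [norm_nonneg (x - y), sq_nonneg L]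
  have hzpos : 0 < ‖z‖ := by simpa using hz0
  obtain ⟨φ, ψ, hφ, -, hψ, hψ1, hL⟩ := h (‖z‖⁻¹ • z) (norm_inv_norm_smul_of_ne_zero hz0)
  have hψz : ‖ψ z‖ = ‖z‖ := by
    rw [map_smul, norm_smul, norm_inv, norm_norm] at hψ1
    field_simp at hψ1
    exact hψ1
  have hpar : 4 * ‖ψ z‖ ^ 2 + ‖ψ (x - y)‖ ^ 2 = 2 * (‖ψ x‖ ^ 2 + ‖ψ y‖ ^ 2) := by
    have := parallelogram_law_with_norm ℝ (ψ x) (ψ y)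
    rw [hz, map_smul, norm_smul, map_add, map_sub]
    norm_num
    nlinarith
  have hψx : ‖ψ x‖ ^ 2 ≤ 1 := pow_le_one₀ (norm_nonneg _) ((hψ x).trans hx)
  have hψy : ‖ψ y‖ ^ 2 ≤ 1 := pow_le_one₀ (norm_nonneg _) ((hψ y).trans hy)
  have hd : ‖x - y‖ ^ 2 ≤ L ^ 2 * ‖ψ (x - y)‖ ^ 2 := by
    rw [← mul_pow]
    exact pow_le_pow_left₀ (norm_nonneg _) ((hφ _).trans (hL _)) 2
  rw [hψz] at hpar
  have hz1 : ‖z‖ ^ 2 ≤ 1 := by nlinarith [sq_nonneg ‖ψ (x - y)‖]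
  have hz1' : ‖z‖ ≤ 1 := by nlinarith
  have h1 : ‖ψ (x - y)‖ ^ 2 ≤ 8 * (1 - ‖z‖) := by nlinarith
  nlinarith [mul_le_mul_of_nonneg_left h1 (sq_nonneg L)]

lemma UniformlyEuclideanPinched.smoothnessPowerTypeTwo (h : UniformlyEuclideanPinched X) :
    SmoothnessPowerTypeTwo X := by
  obtain ⟨L, h⟩ := h
  rw [smoothnessPowerTypeTwo_iff]
  refine ⟨L ^ 2 / 2, fun x y hx => ?_⟩
  obtain ⟨φ, ψ, hφ, hφx, hψ, hψx, hL⟩ := h x hx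
  have hL0 : 0 ≤ L := by
    have := hL x
    rw [hφx, hψx] at this
    linarith
  have hpar := parallelogram_law_with_norm ℝ (φ x) (φ y)
  rw [← map_add, ← map_sub, hφx] at hpar
  have hy : ‖φ y‖ ^ 2 ≤ L ^ 2 * ‖y‖ ^ 2 := by
    rw [← mul_pow]
    exact pow_le_pow_left₀ (norm_nonneg _) ((hL y).trans (mul_le_mul_of_nonneg_left (hψ y) hL0)) 2
  -- `2 * a ≤ 1 + a ^ 2` linearizes both summands.
  nlinarith [hφ (x + y), hφ (x - y), sq_nonneg (‖φ (x + y)‖ - 1), sq_nonneg (‖φ (x - y)‖ - 1)]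

/-! ### Ellipsoids from support functionals -/

lemma le_norm_add_sq_of_convexity {c : ℝ} (hc0 : 0 ≤ c) (hc1 : c ≤ 1)
    (hc : ∀ x y : X, ‖x‖ ≤ 1 → ‖y‖ ≤ 1 → c * ‖x - y‖ ^ 2 ≤ 1 - ‖(1 / 2 : ℝ) • (x + y)‖)
    {x h : X} (hx : ‖x‖ = 1) {f : StrongDual ℝ X} (hf : ‖f‖ = 1) (hfx : f x = 1) (hfh : f h = 0)
    (t : ℝ) : t ^ 2 + c * ‖h‖ ^ 2 ≤ ‖t • x + h‖ ^ 2 := by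
  have hle : ∀ u, f u ≤ ‖u‖ := fun u => by
    simpa [hf] using (le_abs_self _).trans (f.le_opNorm u)
  have key : ∀ k : X, f k = 0 → 1 + c * ‖k‖ ^ 2 ≤ ‖x + k‖ ^ 2 := fun k hfk => by
    have hN : 1 ≤ ‖x + k‖ := by simpa [hfx, hfk] using hle (x + k)
    set N := ‖x + k‖ with hNdef
    have hNpos : 0 < N := by linarith
    -- The points `x / N` and `(x + k) / N` of the unit ball have a midpoint of norm at least `1 / N`.
    have h1 := hc (N⁻¹ • x) (N⁻¹ • (x + k))
      (by rw [norm_smul, hx, norm_inv, Real.norm_of_nonneg hNpos.le, mul_one]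
          exact inv_le_one_of_one_le₀ hN)
      (by rw [norm_smul, norm_inv, Real.norm_of_nonneg hNpos.le, ← hNdef,
            inv_mul_cancel₀ hNpos.ne'])
    have h2 : N⁻¹ ≤ ‖(1 / 2 : ℝ) • (N⁻¹ • x + N⁻¹ • (x + k))‖ := by
      refine le_trans (le_of_eq ?_) (hle _)
      simp [hfx, hfk]
      ring
    have h3 : N⁻¹ • x - N⁻¹ • (x + k) = -(N⁻¹ • k) := by
      rw [smul_add]
      abel
    rw [h3, norm_neg, norm_smul, norm_inv, Real.norm_of_nonneg hNpos.le, mul_pow] at h1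
    have h4 : c * (N⁻¹ ^ 2 * ‖k‖ ^ 2) ≤ 1 - N⁻¹ := by linarith
    have h5 := mul_le_mul_of_nonneg_left h4 (sq_nonneg N)
    have h6 : N ^ 2 * (c * (N⁻¹ ^ 2 * ‖k‖ ^ 2)) = c * ‖k‖ ^ 2 := by field_simp
    have h7 : N ^ 2 * (1 - N⁻¹) = N ^ 2 - N := by field_simp
    linarith
  by_cases ht : t = 0
  · subst ht
    simp only [zero_smul, zero_add]
    nlinarith [sq_nonneg ‖h‖]
  · have h1 := key (t⁻¹ • h) (by simp [hfh])
    have h2 : t • x + h = t • (x + t⁻¹ • h) := by rw [smul_add, smul_inv_smul₀ ht]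
    rw [h2, norm_smul, mul_pow, Real.norm_eq_abs, sq_abs]
    rw [norm_smul, mul_pow, Real.norm_eq_abs, sq_abs] at h1
    have h3 := mul_le_mul_of_nonneg_left h1 (sq_nonneg t)
    have h4 : t ^ 2 * (1 + c * (t⁻¹ ^ 2 * ‖h‖ ^ 2)) = t ^ 2 + c * ‖h‖ ^ 2 := by field_simp
    linarith

lemma norm_add_sq_le_of_smoothness {C : ℝ} (hC0 : 0 ≤ C)
    (hC : ∀ x y : X, ‖x‖ = 1 → (‖x + y‖ + ‖x - y‖) / 2 - 1 ≤ C * ‖y‖ ^ 2)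
    {x h : X} (hx : ‖x‖ = 1) {f : StrongDual ℝ X} (hf : ‖f‖ = 1) (hfx : f x = 1) (hfh : f h = 0)
    (t : ℝ) : ‖t • x + h‖ ^ 2 ≤ t ^ 2 + (4 + 4 * C + 4 * C ^ 2) * ‖h‖ ^ 2 := by
  have hle : ∀ u, f u ≤ ‖u‖ := fun u => by
    simpa [hf] using (le_abs_self _).trans (f.le_opNorm u)
  have key : ∀ k : X, f k = 0 → ‖x + k‖ ≤ 1 + 2 * C * ‖k‖ ^ 2 := fun k hfk => by
    have h1 := hC x k hx
    have h2 : 1 ≤ ‖x - k‖ := by simpa [hfx, hfk] using hle (x - k)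
    linarith
  rcases lt_or_ge |t| ‖h‖ with hth | hth
  · have h1 : ‖t • x + h‖ ≤ 2 * ‖h‖ := by
      refine (norm_add_le _ _).trans ?_
      rw [norm_smul, hx, Real.norm_eq_abs]
      linarith
    have h2 := pow_le_pow_left₀ (norm_nonneg _) h1 2
    nlinarith [sq_nonneg t, mul_nonneg hC0 (sq_nonneg ‖h‖), mul_nonneg (sq_nonneg C) (sq_nonneg ‖h‖)]
  · by_cases ht : t = 0
    · have : h = 0 := by simpa [ht] using hth
      simp [ht, this]
    have htpos : 0 < |t| := abs_pos.2 ht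
    have h1 := key (t⁻¹ • h) (by simp [hfh])
    have h2 : t • x + h = t • (x + t⁻¹ • h) := by rw [smul_add, smul_inv_smul₀ ht]
    rw [norm_smul, norm_inv, Real.norm_eq_abs] at h1
    set s := |t|⁻¹ * ‖h‖ with hs
    have hs0 : 0 ≤ s := by positivity
    have hs1 : s ≤ 1 := by rw [hs, inv_mul_le_iff₀ htpos]; linarith
    have hhs : ‖h‖ = |t| * s := by rw [hs]; field_simp
    rw [h2, norm_smul, mul_pow, Real.norm_eq_abs, hhs, mul_pow, ← sq_abs t]
    have h3 := pow_le_pow_left₀ (norm_nonneg _) h1 2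
    have hs2 : s ^ 2 ≤ 1 := pow_le_one₀ hs0 hs1
    have h4 : (1 + 2 * C * s ^ 2) ^ 2 ≤ 1 + (4 + 4 * C + 4 * C ^ 2) * s ^ 2 := by
      nlinarith [sq_nonneg s, mul_nonneg (mul_nonneg (sq_nonneg C) (sq_nonneg s))
        (sub_nonneg.2 hs2)]
    nlinarith [mul_le_mul_of_nonneg_left (h3.trans h4) (sq_nonneg |t|)]

/-- The Euclidean norm that makes `x` a unit vector orthogonal to the kernel of `f`, and restricts to
the kernel of `f` as `√a` times the standard Euclidean norm of `X`. -/
lemma exists_euclideanCoordinates_of_functional [FiniteDimensional ℝ X] {x : X}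
    {f : StrongDual ℝ X} {a : ℝ} (ha : 0 < a) :
    ∃ φ : EuclideanCoordinates X,
      ∀ u, ‖φ u‖ ^ 2 = f u ^ 2 + a * ‖toEuclidean (u - f u • x)‖ ^ 2 := by
  let A : X →ₗ[ℝ] EuclideanSpace ℝ (Fin (Module.finrank ℝ X)) :=
    (toEuclidean (E := X)).toLinearEquiv.toLinearMap ∘ₗ
      (LinearMap.id - (f : X →ₗ[ℝ] ℝ).smulRight x)
  let b : LinearMap.BilinForm ℝ X :=
    LinearMap.BilinForm.linMulLin (f : X →ₗ[ℝ] ℝ) (f : X →ₗ[ℝ] ℝ) + a • (innerₗ _).compl₁₂ A A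
  have hb : ∀ u v, b u v = f u * f v + a * inner ℝ (A u) (A v) := fun u v => rfl
  have hA : ∀ u, A u = toEuclidean (u - f u • x) := fun u => rfl
  have hbu : ∀ u, b u u = f u ^ 2 + a * ‖toEuclidean (u - f u • x)‖ ^ 2 := fun u => by
    rw [hb, real_inner_self_eq_norm_sq, hA]
    ring
  obtain ⟨φ, hφ⟩ := exists_linearEquiv_euclideanSpace b
    (fun u v => by rw [hb, hb, real_inner_comm, mul_comm (f u)]) (fun u hu => by
      rw [hbu]
      by_cases hfu : f u = 0
      · have : toEuclidean u ≠ 0 := by simpa using hu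
        simp only [hfu, zero_smul, sub_zero]
        positivity
      · positivity)
  exact ⟨φ.toContinuousLinearEquiv, fun u => (hφ u).trans (hbu u)⟩

lemma UniformlyEuclideanPinched.of_moduli [FiniteDimensional ℝ X]
    (hconv : ConvexityPowerTypeTwo X)
    (hsmooth : SmoothnessPowerTypeTwo X) : UniformlyEuclideanPinched X := by
  obtain ⟨c₀, hc₀, hconv⟩ := convexityPowerTypeTwo_iff.1 hconv
  obtain ⟨C₀, hsmooth⟩ := smoothnessPowerTypeTwo_iff.1 hsmooth
  obtain ⟨c, hc0, hc1, hc⟩ : ∃ c : ℝ, 0 < c ∧ c ≤ 1 ∧ ∀ x y : X, ‖x‖ ≤ 1 → ‖y‖ ≤ 1 →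
      c * ‖x - y‖ ^ 2 ≤ 1 - ‖(1 / 2 : ℝ) • (x + y)‖ :=
    ⟨min c₀ 1, by positivity, min_le_right _ _, fun x y hx hy =>
      (mul_le_mul_of_nonneg_right (min_le_left _ _) (sq_nonneg _)).trans (hconv x y hx hy)⟩
  obtain ⟨C, hC0, hC⟩ : ∃ C : ℝ, 0 ≤ C ∧ ∀ x y : X, ‖x‖ = 1 →
      (‖x + y‖ + ‖x - y‖) / 2 - 1 ≤ C * ‖y‖ ^ 2 :=
    ⟨|C₀|, abs_nonneg _, fun x y hx =>
      (hsmooth x y hx).trans (mul_le_mul_of_nonneg_right (le_abs_self _) (sq_nonneg _))⟩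
  obtain ⟨m, M, hm, hM, he⟩ := exists_bounds_of_continuousLinearEquiv (toEuclidean (E := X))
  set D := 4 + 4 * C + 4 * C ^ 2
  have hD : 0 < D := by positivity
  have ha : 0 < D / m ^ 2 := by positivity
  have hb : 0 < c / M ^ 2 := by positivity
  refine ⟨1 + (D / m ^ 2) / (c / M ^ 2), fun x hx => ?_⟩
  have hx0 : ‖x‖ ≠ 0 := by simp [hx]
  obtain ⟨f, hf, hfx⟩ := exists_dual_vector ℝ x hx0
  replace hfx : f x = 1 := by rw [hfx, hx]; simp
  obtain ⟨φ, hφ⟩ := exists_euclideanCoordinates_of_functional (x := x) (f := f) ha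
  obtain ⟨ψ, hψ⟩ := exists_euclideanCoordinates_of_functional (x := x) (f := f) hb
  have hker : ∀ u, f (u - f u • x) = 0 := fun u => by simp [hfx]
  have hdecomp : ∀ u, f u • x + (u - f u • x) = u := fun u => by abel
  refine ⟨φ, ψ, fun u => ?_, ?_, fun u => ?_, ?_, fun u => ?_⟩
  · refine le_of_sq_le_sq ?_ (norm_nonneg _)
    have h1 := norm_add_sq_le_of_smoothness hC0 hC hx hf hfx (hker u) (f u)
    rw [hdecomp] at h1
    refine h1.trans ?_
    rw [hφ]
    refine add_le_add le_rfl ?_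
    have h2 := pow_le_pow_left₀ (by positivity) (he (u - f u • x)).1 2
    rw [div_mul_eq_mul_div, le_div_iff₀ (by positivity)]
    calc _ = D * (m * ‖u - f u • x‖) ^ 2 := by ring
      _ ≤ _ := by gcongr
  · rw [← sq_eq_sq₀ (norm_nonneg _) zero_le_one, hφ]
    simp [hfx]
  · refine le_of_sq_le_sq ?_ (norm_nonneg _)
    have h1 := le_norm_add_sq_of_convexity hc0.le hc1 hc hx hf hfx (hker u) (f u)
    rw [hdecomp] at h1
    refine le_trans ?_ h1
    rw [hψ]
    refine add_le_add le_rfl ?_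
    have h2 := pow_le_pow_left₀ (norm_nonneg _) (he (u - f u • x)).2 2
    rw [div_mul_eq_mul_div, div_le_iff₀ (by positivity)]
    calc _ ≤ c * (M * ‖u - f u • x‖) ^ 2 := by gcongr
      _ = _ := by ring
  · rw [← sq_eq_sq₀ (norm_nonneg _) zero_le_one, hψ]
    simp [hfx]
  · set a := D / m ^ 2
    set b := c / M ^ 2
    have hab : 0 < a / b := by positivity
    refine le_of_sq_le_sq ?_ (by positivity)
    rw [mul_pow, hφ, hψ]
    set w := ‖toEuclidean (u - f u • x)‖ ^ 2
    have hw : 0 ≤ w := by positivity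
    have h1 : a = a / b * b := by field_simp
    have h2 : 0 ≤ b * w := by positivity
    have h3 : a * w = a / b * (b * w) := by rw [← mul_assoc, ← h1]
    rw [h3]
    nlinarith [mul_nonneg hab.le h2, mul_nonneg hab.le (sq_nonneg (f u)),
      mul_nonneg (sq_nonneg (a / b)) h2, mul_nonneg (sq_nonneg (a / b)) (sq_nonneg (f u))]

end

theorem proposition3p1 {X : Type*} [NormedAddCommGroup X] [NormedSpace ℝ X]
    [FiniteDimensional ℝ X] :
    List.TFAE
      [BoundedlySemitransitive X,
       BoundedlySemitransitive (StrongDual ℝ X),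
       ∃ lam : ℝ, ∀ x : X, ‖x‖ = 1 → ∃ E F : Set X,
         IsInnerEllipsoidAt E x ∧ IsOuterEllipsoidAt F x ∧ F ⊆ lam • E,
       ConvexityPowerTypeTwo X ∧ SmoothnessPowerTypeTwo X] := by
  rw [exists_ellipsoids_iff]
  tfae_have 1 → 2 := fun h => h.dual
  tfae_have 2 → 1 := fun h => by
    obtain ⟨J, -⟩ := exists_linearIsometryEquiv_doubleDual (X := X)
    exact h.dual.of_linearIsometryEquiv J
  tfae_have 1 → 3 := fun h => h.uniformlyEuclideanPinched
  tfae_have 3 → 1 := fun h => h.boundedlySemitransitive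
  tfae_have 3 → 4 := fun h => ⟨h.convexityPowerTypeTwo, h.smoothnessPowerTypeTwo⟩
  tfae_have 4 → 3 := fun h => .of_moduli h.1 h.2
  tfae_finish
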